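/- Let $\mu$ be Lebesgue measure on $[a,b]$. A \emph{tagged interval} $(I,x)$ is a nondegenerate segment $I\subset[a,b]$ with a point $x\in I$; a \emph{division} is a finite collection of tagged intervals whose segments are pairwise non-overlapping. For a positive function (\emph{gauge}) $\delta$ on a set $E\subset[a,b]$, a division is \emph{tagged in $E$} if all its tags lie in $E$, and then \emph{$\delta$-fine} if $I\subset(x-\delta(x),x+\delta(x))$ for all its elements $(I,x)$. Let $1\le r<\infty$. A function $f\colon[a,b]\to\mathbb R$ is \emph{HK$_r$-integrable} on $[a,b]$ if there is a function $F\in L^r[a,b]$ such that for each $\varepsilon>0$ there is a gauge $\delta$ on $[a,b]$ such that every $\delta$-fine division $\{([c_i,d_i],x_i)\}_{i=1}^q$ satisfies $$\sum_{i=1}^q\Bigl(\frac1{d_i-c_i}\int_{c_i}^{d_i}|F(y)-F(x_i)-f(x_i)(y-x_i)|^r\,dy\Bigr)^{1/r}<\varepsilon .$$ For $F\in L^r[a,b]$ and $E\subset[a,b]$, the \emph{$L^r$-variational measure} of $E$ generated by $F$ is $$V^r_F(E)=\inf_\delta\ \sup\ \sum_{i=1}^q\Bigl(\frac1{|I_i|}\int_{I_i}|F(y)-F(x_i)|^r\,dy\Bigr)^{1/r}\in[0,\infty],$$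 where the infimum is over all gauges $\delta$ on $E$ and the supremum is over all $\delta$-fine divisions $\{(I_i,x_i)\}_{i=1}^q$ tagged in $E$. A function $F\colon[a,b]\to\mathbb R$ is an \emph{ACG-function} if $[a,b]=\bigcup_{n=1}^\infty D_n$ with $F\restriction D_n$ absolutely continuous for every $n$: for each $\varepsilon>0$ there is $\eta>0$ such that $\sum_i|F(d_i)-F(c_i)|<\varepsilon$ for every finite family of non-overlapping intervals $[c_i,d_i]$ with endpoints in $D_n$ and $\sum_i(d_i-c_i)<\eta$. A function $f\colon[a,b]\to\mathbb R$ is \emph{Khintchine integrable} (respectively \emph{Denjoy--Khintchine integrable}) on $[a,b]$ if there is a continuous ACG-function $F\colon[a,b]\to\mathbb R$ with $F'(x)=f(x)$ (respectively $F'_{\mathrm{ap}}(x)=f(x)$) for almost all $x\in[a,b]$. Here $F'_{\mathrm{ap}}(x)=\alpha$ means that for each $\varepsilon>0$ the set $A=\{y\in[a,b]\setminus\{x\}:|\frac{F(y)-F(x)}{y-x}-\alpha|<\varepsilon\}$ is measurable and $\mu(A\cap[x-h,x+h])/(2h)\to1$ as $h\searrow0$. \textbf{Theorem.} There exists a function $f$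 on $[0,1]$ which is Khintchine integrable and Denjoy--Khintchine integrable on $[0,1]$, but which is HK$_r$-integrable on $[0,1]$ for no $r\ge1$. Moreover, $f$ can be chosen so that, with $C\subset[0,1]$ the Cantor ternary set, there is a continuous ACG-function $F$ on $[0,1]$ that is differentiable at every point of $[0,1]\setminus C$ with $F'=f$ there, and that satisfies $V^r_F(C)=\infty$ for every $r\ge1$. -/

import Mathlib

open MeasureTheory Set Filter Topology

noncomputable section

namespace LrHK

/-- A tagged interval in `[a, b]`: a nondegenerate segment `[left, right] ⊆ [a, b]` together with
a tag `tag ∈ [left, right]`. -/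
structure TaggedInterval (a b : ℝ) where
  left : ℝ
  right : ℝ
  tag : ℝ
  a_le_left : a ≤ left
  left_lt_right : left < right
  right_le_b : right ≤ b
  tag_mem : tag ∈ Icc left right

/-- A division: a finite family of tagged intervals, pairwise without common inner points. -/
def IsDivision {a b : ℝ} {q : ℕ} (I : Fin q → TaggedInterval a b) : Prop :=
  ∀ i j, i ≠ j → Disjoint (Ioo (I i).left (I i).right) (Ioo (I j).left (I j).right)

/-- `δ` is a gauge on `E`; its values outside `E` are irrelevant. -/
def IsGaugeOn (δ : ℝ → ℝ) (E : Set ℝ) : Prop := ∀ x ∈ E, 0 < δ x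

/-- The tagged interval `(I, x)` is `δ`-fine: `I ⊆ (x - δ(x), x + δ(x))`. -/
def TaggedInterval.IsFine {a b : ℝ} (I : TaggedInterval a b) (δ : ℝ → ℝ) : Prop :=
  Icc I.left I.right ⊆ Ioo (I.tag - δ I.tag) (I.tag + δ I.tag)

/-- `F` belongs to `L^r[a, b]` (as an everywhere defined function). -/
def InLr (r a b : ℝ) (F : ℝ → ℝ) : Prop :=
  MemLp F (ENNReal.ofReal r) (volume.restrict (Icc a b))

/-- `f` is `L^r`-Henstock–Kurzweil integrable on `[a, b]`. Only the values of `f` on `[a, b]`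
matter. -/
def HKrIntegrable (r a b : ℝ) (f : ℝ → ℝ) : Prop :=
  ∃ F : ℝ → ℝ, InLr r a b F ∧
    ∀ ε : ℝ, 0 < ε → ∃ δ : ℝ → ℝ, IsGaugeOn δ (Icc a b) ∧
      ∀ (q : ℕ) (I : Fin q → TaggedInterval a b), IsDivision I → (∀ i, (I i).IsFine δ) →
        ∑ i, ((1 / ((I i).right - (I i).left)) *
          ∫ y in (I i).left..(I i).right,
            |F y - F (I i).tag - f (I i).tag * (y - (I i).tag)| ^ r) ^ (1 / r) < ε

/-- `Δ_r F(I, x) = ((1 / |I|) ∫_I |F(y) - F(x)|^r dy)^(1/r)`. -/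
def lrDelta (r : ℝ) (F : ℝ → ℝ) {a b : ℝ} (I : TaggedInterval a b) : ℝ :=
  ((1 / (I.right - I.left)) * ∫ y in I.left..I.right, |F y - F I.tag| ^ r) ^ (1 / r)

/-- The `(δ, r)`-variation of `F` on `E ⊆ [a, b]`, with values in `[0, ∞]`: the supremum of
`∑ Δ_r F(I_i, x_i)` over all `δ`-fine divisions in `[a, b]` tagged in `E`. -/
def lrVariation (r a b : ℝ) (F : ℝ → ℝ) (E : Set ℝ) (δ : ℝ → ℝ) : ENNReal :=
  ⨆ (q : ℕ) (I : Fin q → TaggedInterval a b) (_ : IsDivision I) (_ : ∀ i, (I i).IsFine δ)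
    (_ : ∀ i, (I i).tag ∈ E), ENNReal.ofReal (∑ i, lrDelta r F (I i))

/-- The `L^r`-variational measure `V^r_F(E)` generated by `F ∈ L^r[a, b]`: the infimum of the
`(δ, r)`-variations over all gauges `δ` on `E`. -/
def lrVariationalMeasure (r a b : ℝ) (F : ℝ → ℝ) (E : Set ℝ) : ENNReal :=
  ⨅ (δ : ℝ → ℝ) (_ : IsGaugeOn δ E), lrVariation r a b F E δ

/-- The restriction of `F` to the set `D` is absolutely continuous: for every `ε > 0` there is
`η > 0` such that `∑ |F(d_i) - F(c_i)| < ε` for all finite families of non-overlapping intervals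
`[c_i, d_i]` with endpoints in `D` and total length less than `η`. -/
def IsACOn (F : ℝ → ℝ) (D : Set ℝ) : Prop :=
  ∀ ε : ℝ, 0 < ε → ∃ η : ℝ, 0 < η ∧
    ∀ (q : ℕ) (c d : Fin q → ℝ), (∀ i, c i ∈ D ∧ d i ∈ D ∧ c i ≤ d i) →
      (∀ i j, i ≠ j → Disjoint (Ioo (c i) (d i)) (Ioo (c j) (d j))) →
      ∑ i, (d i - c i) < η → ∑ i, |F (d i) - F (c i)| < ε

/-- `F` is an ACG-function on `[a, b]`: `[a, b]` is a countable union of sets on each of which `F`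
is absolutely continuous. -/
def IsACG (a b : ℝ) (F : ℝ → ℝ) : Prop :=
  ∃ D : ℕ → Set ℝ, Icc a b = ⋃ n, D n ∧ ∀ n, IsACOn F (D n)

/-- The (Lebesgue) measurable set `E` has a density point at `x`. -/
def HasDensityPoint (E : Set ℝ) (x : ℝ) : Prop :=
  NullMeasurableSet E volume ∧
    Tendsto (fun h : ℝ => volume.real (E ∩ Icc (x - h) (x + h)) / (2 * h)) (𝓝[>] 0) (𝓝 1)

/-- `α` is the (bilateral) approximate derivative at `x ∈ (a, b)` of `F : [a, b] → ℝ`. -/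
def HasApproxDerivAt (a b : ℝ) (F : ℝ → ℝ) (α x : ℝ) : Prop :=
  ∀ ε : ℝ, 0 < ε →
    HasDensityPoint {y ∈ Icc a b | y ≠ x ∧ |(F y - F x) / (y - x) - α| < ε} x

/-- `f` is Khintchine integrable on `[a, b]`: it is a.e. the ordinary derivative of a continuous
ACG-function. -/
def KhintchineIntegrable (a b : ℝ) (f : ℝ → ℝ) : Prop :=
  ∃ F : ℝ → ℝ, ContinuousOn F (Icc a b) ∧ IsACG a b F ∧
    ∀ᵐ x ∂(volume.restrict (Icc a b)), HasDerivWithinAt F (f x) (Icc a b) x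

/-- `f` is Denjoy–Khintchine integrable on `[a, b]`: it is a.e. the approximate derivative of a
continuous ACG-function. -/
def DenjoyKhintchineIntegrable (a b : ℝ) (f : ℝ → ℝ) : Prop :=
  ∃ F : ℝ → ℝ, ContinuousOn F (Icc a b) ∧ IsACG a b F ∧
    ∀ᵐ x ∂(volume.restrict (Icc a b)), HasApproxDerivAt a b F (f x) x

end LrHK

end

namespace LrHK

/-! ### The Cantor set: cells, gaps, measure -/

/-! Let `F` (`cantorBump`) vanish on C and be a parabola of height `√L / 4` on each gap of length
`L`. It is bounded by the square root of the distance to C, hence continuous; it is zero on C and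
Lipschitz on each closed gap, hence ACG. As C is null, `f = F'` off C, `f = 0` on C, is integrable
in both Khintchine senses.

The level `n` cells carry `2 ^ n` gaps of length `3 ^ (-n-1)`, and the mean oscillation of `F` on
each is comparable to `√3 ^ (-n)`. Since `2 / √3 > 1`, the sums diverge. By Baire, a gauge on C is
bounded below on a dense subset of some portion of C, so fine divisions tagged in C can catch all
gaps of a deep level there (`exists_fine_division_large`). This gives infinite variational measure.

An HK_r primitive `G` of `f` need not be `F`. On a gap, both have first order expansions with the
same slope, `G` in the mean and `F` pointwise; a second difference argument makes `G - F` a.e.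
constant there (`integral_sub_eq_of_meanDeviation`). So `G` oscillates like `F` on gaps
(`le_integral_abs_sub`), and because `f = 0` on C the same divisions refute HK_r integrability.
Jensen's inequality reduces every `r ≥ 1` to mean values with exponent 1. -/

theorem div_three_mem_cantorSet {x : ℝ} (hx : x ∈ cantorSet) : x / 3 ∈ cantorSet := by
  rw [cantorSet_eq_union_halves]; exact Or.inl ⟨x, hx, rfl⟩

theorem two_add_div_three_mem_cantorSet {x : ℝ} (hx : x ∈ cantorSet) :
    (2 + x) / 3 ∈ cantorSet := by
  rw [cantorSet_eq_union_halves]; exact Or.inr ⟨x, hx, rfl⟩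

theorem one_mem_cantorSet : (1 : ℝ) ∈ cantorSet := by
  simp only [cantorSet, mem_iInter]
  intro n
  induction n with
  | zero => simp
  | succ n ih => exact Or.inr ⟨1, ih, by norm_num⟩

theorem mem_cantorSet_cases {x : ℝ} (hx : x ∈ cantorSet) :
    3 * x ∈ cantorSet ∨ 3 * x - 2 ∈ cantorSet := by
  rw [cantorSet_eq_union_halves] at hx
  rcases hx with ⟨y, hy, rfl⟩ | ⟨y, hy, rfl⟩
  · left; convert hy using 1; ring
  · right; convert hy using 1; ring

theorem notMem_cantorSet_of_mem_middle {x : ℝ} (hx : x ∈ Ioo (1 / 3 : ℝ) (2 / 3)) :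
    x ∉ cantorSet := by
  intro h
  rcases mem_cantorSet_cases h with h | h
  · linarith [hx.1, (cantorSet_subset_unitInterval h).2]
  · linarith [hx.2, (cantorSet_subset_unitInterval h).1]

/-- C is covered by two copies of itself scaled by 1/3, so its finite measure is at most 2/3 of
itself. -/
theorem volume_cantorSet : volume cantorSet = 0 := by
  have h1 : volume cantorSet ≤ 1 := by
    simpa using measure_mono (μ := volume) cantorSet_subset_unitInterval
  have himg : ∀ t : ℝ, volume ((fun x : ℝ => (t + x) / 3) '' cantorSet)
      = ENNReal.ofReal (1 / 3) * volume cantorSet := by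
    intro t
    have : (fun x : ℝ => (t + x) / 3) '' cantorSet
        = AffineMap.homothety (t / 2) (1 / 3 : ℝ) '' cantorSet := by
      apply image_congr
      intro x _
      simp [AffineMap.homothety_apply]
      ring
    rw [this, Measure.addHaar_image_homothety]
    simp [abs_of_pos]
  have h2 : volume cantorSet ≤ ENNReal.ofReal (2 / 3) * volume cantorSet := by
    have h0 := himg 0
    simp only [zero_add] at h0
    calc volume cantorSet = volume ((fun x : ℝ => x / 3) '' cantorSet
          ∪ (fun x ↦ (2 + x) / 3) '' cantorSet) := congrArg _ cantorSet_eq_union_halves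
      _ ≤ _ := measure_union_le _ _
      _ = _ := by
        rw [h0, himg 2, ← add_mul, ← ENNReal.ofReal_add (by norm_num) (by norm_num)]
        norm_num
  have hfin : volume cantorSet ≠ ⊤ := ne_top_of_le_ne_top ENNReal.one_ne_top h1
  have h3 := ENNReal.toReal_mono (ENNReal.mul_ne_top ENNReal.ofReal_ne_top hfin) h2
  rw [ENNReal.toReal_mul, ENNReal.toReal_ofReal (by norm_num)] at h3
  have h4 : (volume cantorSet).toReal = 0 := by
    have := ENNReal.toReal_nonneg (a := volume cantorSet)
    linarith
  exact ((ENNReal.toReal_eq_zero_iff _).1 h4).resolve_right hfin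

/-- The numerators `a` of the left end points `a / 3 ^ n` of the level `n` cells of the Cantor
set. -/
def cantorCells : ℕ → Finset ℕ
  | 0 => {0}
  | n + 1 => (cantorCells n).image (fun a => 3 * a) ∪ (cantorCells n).image (fun a => 3 * a + 2)

theorem card_cantorCells (n : ℕ) : (cantorCells n).card = 2 ^ n := by
  induction n with
  | zero => rfl
  | succ n ih =>
    rw [cantorCells, Finset.card_union_of_disjoint, Finset.card_image_of_injective,
      Finset.card_image_of_injective, ih, pow_succ]
    · ring
    · intro a b h; simpa using h
    · intro a b h; simpa using h
    · rw [Finset.disjoint_left]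
      intro x h1 h2
      simp only [Finset.mem_image] at h1 h2
      obtain ⟨a, -, ha⟩ := h1
      obtain ⟨b, -, hb⟩ := h2
      omega

/-- Self-similarity: with the next lemma, C is the union of the copies `(a + C) / 3 ^ n` over the
level `n` cells. -/
theorem mem_cantorSet_of_mem_cell {n a : ℕ} (ha : a ∈ cantorCells n) {c : ℝ}
    (hc : c ∈ cantorSet) : (a + c) / 3 ^ n ∈ cantorSet := by
  induction n generalizing a c with
  | zero => simp_all [cantorCells]
  | succ n ih =>
    simp only [cantorCells, Finset.mem_union, Finset.mem_image] at ha
    rcases ha with ⟨b, hb, rfl⟩ | ⟨b, hb, rfl⟩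
    · convert ih hb (div_three_mem_cantorSet hc) using 1
      push_cast; field_simp; ring
    · convert ih hb (two_add_div_three_mem_cantorSet hc) using 1
      push_cast; field_simp; ring

theorem exists_cell_of_mem_cantorSet (n : ℕ) {x : ℝ} (hx : x ∈ cantorSet) :
    ∃ a ∈ cantorCells n, 3 ^ n * x - a ∈ cantorSet := by
  induction n with
  | zero => exact ⟨0, by simp [cantorCells], by simpa using hx⟩
  | succ n ih =>
    obtain ⟨a, ha, h⟩ := ih
    rcases mem_cantorSet_cases h with h | h
    · refine ⟨3 * a, ?_, ?_⟩
      · simp only [cantorCells, Finset.mem_union, Finset.mem_image]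
        exact Or.inl ⟨a, ha, rfl⟩
      · convert h using 1; push_cast; ring
    · refine ⟨3 * a + 2, ?_, ?_⟩
      · simp only [cantorCells, Finset.mem_union, Finset.mem_image]
        exact Or.inr ⟨a, ha, rfl⟩
      · convert h using 1; push_cast; ring

/-- The numerators are the numbers with ternary digits 0 and 2 only; this concatenates digit
strings, locating the subcells of a fixed cell. -/
theorem cantorCells_add {k a : ℕ} (ha : a ∈ cantorCells k) (j : ℕ) {b : ℕ}
    (hb : b ∈ cantorCells j) : 3 ^ j * a + b ∈ cantorCells (k + j) := by
  induction j generalizing b with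
  | zero => simp_all [cantorCells]
  | succ j ih =>
    rw [← add_assoc]
    simp only [cantorCells, Finset.mem_union, Finset.mem_image] at hb ⊢
    rcases hb with ⟨b, hb, rfl⟩ | ⟨b, hb, rfl⟩
    · exact Or.inl ⟨_, ih hb, by ring⟩
    · exact Or.inr ⟨_, ih hb, by ring⟩

theorem cantorCells_lt {j b : ℕ} (hb : b ∈ cantorCells j) : b < 3 ^ j := by
  induction j generalizing b with
  | zero => simp_all [cantorCells]
  | succ j ih =>
    simp only [cantorCells, Finset.mem_union, Finset.mem_image] at hb
    rcases hb with ⟨b, hb, rfl⟩ | ⟨b, hb, rfl⟩ <;> have := ih hb <;> rw [pow_succ] <;> omega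

/-- `(u, v)` is a contiguous interval of the Cantor set. -/
structure IsCantorGap (u v : ℝ) : Prop where
  left_mem : u ∈ cantorSet
  right_mem : v ∈ cantorSet
  lt : u < v
  notMem : ∀ y ∈ Ioo u v, y ∉ cantorSet

theorem isCantorGap_of_cell {n a : ℕ} (ha : a ∈ cantorCells n) :
    IsCantorGap ((a + 1 / 3) / 3 ^ n) ((a + 2 / 3) / 3 ^ n) where
  left_mem := mem_cantorSet_of_mem_cell ha (div_three_mem_cantorSet one_mem_cantorSet)
  right_mem := mem_cantorSet_of_mem_cell ha (by
    simpa using two_add_div_three_mem_cantorSet zero_mem_cantorSet)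
  lt := by gcongr; norm_num
  notMem := by
    rintro y ⟨h1, h2⟩ hy
    rw [div_lt_iff₀ (by positivity)] at h1
    rw [lt_div_iff₀ (by positivity)] at h2
    obtain ⟨b, -, hb⟩ := exists_cell_of_mem_cantorSet n hy
    have hb' := cantorSet_subset_unitInterval hb
    have e1 : (a : ℝ) < b + 1 := by linarith [hb'.2]
    have e2 : (b : ℝ) < a + 1 := by linarith [hb'.1]
    -- The cells `a` and `b` overlap in more than an end point, so the integers differ by less than
    -- 1.
    have e : a = b := by
      have e1' : a < b + 1 := by exact_mod_cast e1
      have e2' : b < a + 1 := by exact_mod_cast e2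
      omega
    subst e
    exact notMem_cantorSet_of_mem_middle ⟨by linarith, by linarith⟩ hb

/-- The largest point of the Cantor set on the left of `x`. -/
noncomputable def cantorLeft (x : ℝ) : ℝ := sSup (cantorSet ∩ Iic x)

/-- The smallest point of the Cantor set on the right of `x`. -/
noncomputable def cantorRight (x : ℝ) : ℝ := sInf (cantorSet ∩ Ici x)

theorem isGreatest_cantorLeft {x : ℝ} (hx : 0 ≤ x) :
    IsGreatest (cantorSet ∩ Iic x) (cantorLeft x) :=
  (isCompact_cantorSet.inter_right isClosed_Iic).isGreatest_sSup ⟨0, zero_mem_cantorSet, hx⟩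

theorem isLeast_cantorRight {x : ℝ} (hx : x ≤ 1) :
    IsLeast (cantorSet ∩ Ici x) (cantorRight x) :=
  (isCompact_cantorSet.inter_right isClosed_Ici).isLeast_sInf ⟨1, one_mem_cantorSet, hx⟩

theorem cantorLeft_of_mem {x : ℝ} (hx : x ∈ cantorSet) : cantorLeft x = x :=
  IsGreatest.csSup_eq ⟨⟨hx, self_mem_Iic⟩, fun _ h => h.2⟩

theorem IsCantorGap.cantorLeft_eq {u v x : ℝ} (h : IsCantorGap u v) (hx : x ∈ Ioo u v) :
    cantorLeft x = u :=
  IsGreatest.csSup_eq ⟨⟨h.left_mem, hx.1.le⟩, fun y hy => not_lt.1 fun hlt =>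
    h.notMem y ⟨hlt, hy.2.trans_lt hx.2⟩ hy.1⟩

theorem IsCantorGap.cantorRight_eq {u v x : ℝ} (h : IsCantorGap u v) (hx : x ∈ Ioo u v) :
    cantorRight x = v :=
  IsLeast.csInf_eq ⟨⟨h.right_mem, hx.2.le⟩, fun y hy => not_lt.1 fun hlt =>
    h.notMem y ⟨hx.1.trans_le hy.2, hlt⟩ hy.1⟩

theorem exists_isCantorGap {x : ℝ} (hx : x ∈ Icc (0 : ℝ) 1) (hxC : x ∉ cantorSet) :
    x ∈ Ioo (cantorLeft x) (cantorRight x) ∧ IsCantorGap (cantorLeft x) (cantorRight x) := by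
  have h1 := isGreatest_cantorLeft hx.1
  have h2 := isLeast_cantorRight hx.2
  have l1 : cantorLeft x < x := lt_of_le_of_ne h1.1.2 fun h => hxC (h ▸ h1.1.1)
  have l2 : x < cantorRight x := lt_of_le_of_ne h2.1.2 fun h => hxC (h ▸ h2.1.1)
  refine ⟨⟨l1, l2⟩, h1.1.1, h2.1.1, l1.trans l2, fun y hy hyC => ?_⟩
  rcases le_total y x with h | h
  · exact absurd (h1.2 ⟨hyC, h⟩) (not_le.2 hy.1)
  · exact absurd (h2.2 ⟨hyC, h⟩) (not_le.2 hy.2)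

theorem IsCantorGap.Icc_subset {u v : ℝ} (h : IsCantorGap u v) : Icc u v ⊆ Icc 0 1 :=
  Icc_subset_Icc (cantorSet_subset_unitInterval h.left_mem).1
    (cantorSet_subset_unitInterval h.right_mem).2

/-! ### The primitive -/

/-- A quadratic bump on `[u, v]` of height comparable to `√(v - u)`. -/
noncomputable def gapBump (u v x : ℝ) : ℝ := (x - u) * (v - x) / ((v - u) * √(v - u))

/-- The function vanishing on the Cantor set which is a quadratic bump on every contiguous
interval. -/
noncomputable def cantorBump (x : ℝ) : ℝ := gapBump (cantorLeft x) (cantorRight x) x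

theorem cantorBump_of_mem {x : ℝ} (hx : x ∈ cantorSet) : cantorBump x = 0 := by
  simp [cantorBump, gapBump, cantorLeft_of_mem hx]

theorem IsCantorGap.cantorBump_eq {u v x : ℝ} (h : IsCantorGap u v) (hx : x ∈ Icc u v) :
    cantorBump x = gapBump u v x := by
  rcases eq_or_lt_of_le hx.1 with rfl | h1
  · rw [cantorBump_of_mem h.left_mem]; simp [gapBump]
  rcases eq_or_lt_of_le hx.2 with rfl | h2
  · rw [cantorBump_of_mem h.right_mem]; simp [gapBump]
  rw [cantorBump, h.cantorLeft_eq ⟨h1, h2⟩, h.cantorRight_eq ⟨h1, h2⟩]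

theorem gapBump_nonneg {u v x : ℝ} (hx : x ∈ Icc u v) : 0 ≤ gapBump u v x := by
  have h1 := sub_nonneg.2 hx.1
  have h2 := sub_nonneg.2 hx.2
  have h3 := sub_nonneg.2 (hx.1.trans hx.2)
  unfold gapBump
  positivity

theorem gapBump_le_aux {p q : ℝ} (hp : 0 ≤ p) (hq : 0 ≤ q) :
    p * q / ((p + q) * √(p + q)) ≤ √p := by
  rcases hp.eq_or_lt with rfl | hp'
  · simp
  have h : 0 < p + q := by linarith
  rw [div_le_iff₀ (by positivity)]
  have h1 : √p ≤ √(p + q) := Real.sqrt_le_sqrt (by linarith)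
  calc p * q = √p * √p * q := by rw [Real.mul_self_sqrt hp]
    _ ≤ √p * √(p + q) * (p + q) := by gcongr; linarith
    _ = _ := by ring

theorem gapBump_le_left {u v x : ℝ} (hx : x ∈ Icc u v) : gapBump u v x ≤ √(x - u) := by
  have := gapBump_le_aux (sub_nonneg.2 hx.1) (sub_nonneg.2 hx.2)
  rwa [show x - u + (v - x) = v - u by ring] at this

theorem gapBump_le_right {u v x : ℝ} (hx : x ∈ Icc u v) : gapBump u v x ≤ √(v - x) := by
  have := gapBump_le_aux (sub_nonneg.2 hx.2) (sub_nonneg.2 hx.1)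
  rwa [show v - x + (x - u) = v - u by ring, mul_comm] at this

theorem hasDerivAt_gapBump (u v x : ℝ) :
    HasDerivAt (gapBump u v) ((u + v - 2 * x) / ((v - u) * √(v - u))) x := by
  have := (((hasDerivAt_id x).sub_const u).mul ((hasDerivAt_id x).const_sub v)).div_const
    ((v - u) * √(v - u))
  refine this.congr_deriv ?_
  simp only [id]
  ring

theorem continuous_gapBump (u v : ℝ) : Continuous (gapBump u v) := by
  unfold gapBump; fun_prop

/-- An end point of the gap around `x` separates `x` from `c`. This yields continuity at the points
of C. -/
theorem abs_cantorBump_le {x c : ℝ} (hx : x ∈ Icc (0 : ℝ) 1) (hc : c ∈ cantorSet) :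
    |cantorBump x| ≤ √|x - c| := by
  by_cases hxC : x ∈ cantorSet
  · simp [cantorBump_of_mem hxC]
  obtain ⟨hmem, hgap⟩ := exists_isCantorGap hx hxC
  set u := cantorLeft x
  set v := cantorRight x
  have hmem' := Ioo_subset_Icc_self hmem
  rw [hgap.cantorBump_eq hmem', abs_of_nonneg (gapBump_nonneg hmem')]
  rcases le_total c x with h | h
  · have : c ≤ u := not_lt.1 fun hlt => hgap.notMem c ⟨hlt, h.trans_lt hmem.2⟩ hc
    refine (gapBump_le_left hmem').trans (Real.sqrt_le_sqrt ?_)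
    rw [abs_of_nonneg (by linarith)]; linarith
  · have : v ≤ c := not_lt.1 fun hlt => hgap.notMem c ⟨hmem.1.trans_le h, hlt⟩ hc
    refine (gapBump_le_right hmem').trans (Real.sqrt_le_sqrt ?_)
    rw [abs_of_nonpos (by linarith)]; linarith

theorem IsCantorGap.hasDerivAt_cantorBump {u v x : ℝ} (h : IsCantorGap u v) (hx : x ∈ Ioo u v) :
    HasDerivAt cantorBump ((u + v - 2 * x) / ((v - u) * √(v - u))) x := by
  refine (hasDerivAt_gapBump u v x).congr_of_eventuallyEq ?_
  filter_upwards [Ioo_mem_nhds hx.1 hx.2] with y hy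
  exact h.cantorBump_eq (Ioo_subset_Icc_self hy)

theorem continuousOn_cantorBump : ContinuousOn cantorBump (Icc 0 1) := by
  intro x hx
  by_cases hxC : x ∈ cantorSet
  · rw [ContinuousWithinAt, cantorBump_of_mem hxC]
    refine squeeze_zero_norm' (a := fun y => √|y - x|) ?_ ?_
    · filter_upwards [self_mem_nhdsWithin] with y hy
      exact abs_cantorBump_le hy hxC
    · have : Continuous fun y : ℝ => √|y - x| := by fun_prop
      simpa using (this.tendsto x).mono_left nhdsWithin_le_nhds
  · obtain ⟨hmem, hgap⟩ := exists_isCantorGap hx hxC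
    exact (hgap.hasDerivAt_cantorBump hmem).continuousAt.continuousWithinAt

theorem isACOn_of_lipschitz {F : ℝ → ℝ} {D : Set ℝ} {K : ℝ}
    (h : ∀ x ∈ D, ∀ y ∈ D, |F y - F x| ≤ K * |y - x|) : IsACOn F D := by
  intro ε hε
  refine ⟨ε / (|K| + 1), by positivity, fun q c d hcd _ hsum => ?_⟩
  calc ∑ i, |F (d i) - F (c i)| ≤ ∑ i, (|K| + 1) * (d i - c i) := by
        refine Finset.sum_le_sum fun i _ => (h _ (hcd i).1 _ (hcd i).2.1).trans ?_
        have := sub_nonneg.2 (hcd i).2.2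
        rw [abs_of_nonneg this]
        gcongr
        linarith [le_abs_self K]
    _ = (|K| + 1) * ∑ i, (d i - c i) := by rw [Finset.mul_sum]
    _ < (|K| + 1) * (ε / (|K| + 1)) := by gcongr
    _ = ε := by field_simp

theorem IsCantorGap.isACOn_cantorBump {u v : ℝ} (h : IsCantorGap u v) :
    IsACOn cantorBump (Icc u v) := by
  have hL : 0 < v - u := sub_pos.2 h.lt
  have hs : 0 < √(v - u) := Real.sqrt_pos.2 hL
  -- The constant is the slope of the parabola at the end points; it blows up for short gaps, so
  -- each gap needs its own piece.
  refine isACOn_of_lipschitz (K := 1 / √(v - u)) fun x hx y hy => ?_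
  rw [h.cantorBump_eq hx, h.cantorBump_eq hy]
  have e : gapBump u v y - gapBump u v x
      = (y - x) * (u + v - x - y) / ((v - u) * √(v - u)) := by
    unfold gapBump; ring
  have hb : |u + v - x - y| ≤ v - u :=
    abs_le.2 ⟨by linarith [hx.2, hy.2], by linarith [hx.1, hy.1]⟩
  rw [e, abs_div, abs_mul, abs_of_pos (mul_pos hL hs), div_le_iff₀ (by positivity)]
  calc |y - x| * |u + v - x - y| ≤ |y - x| * (v - u) := by gcongr
    _ = _ := by field_simp

/-- The pieces are C and the closed gaps, enumerated with repetitions by the rationals they contain.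
-/
theorem isACG_cantorBump : IsACG 0 1 cantorBump := by
  classical
  let e : ℕ ≃ ℚ := (Denumerable.eqv ℚ).symm
  let D : ℕ → Set ℝ := fun n => Nat.casesOn n cantorSet fun m =>
    if (e m : ℝ) ∈ Icc (0 : ℝ) 1 \ cantorSet then
      Icc (cantorLeft (e m)) (cantorRight (e m)) else ∅
  refine ⟨D, Subset.antisymm (fun x hx => ?_) (iUnion_subset fun n => ?_), fun n => ?_⟩
  · rw [mem_iUnion]
    by_cases hxC : x ∈ cantorSet
    · exact ⟨0, hxC⟩
    obtain ⟨hmem, hgap⟩ := exists_isCantorGap hx hxC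
    obtain ⟨q, hq1, hq2⟩ := exists_rat_btwn hgap.lt
    have hq : (q : ℝ) ∈ Ioo (cantorLeft x) (cantorRight x) := ⟨hq1, hq2⟩
    refine ⟨e.symm q + 1, ?_⟩
    have hq' : (q : ℝ) ∈ Icc (0 : ℝ) 1 \ cantorSet :=
      ⟨hgap.Icc_subset (Ioo_subset_Icc_self hq), hgap.notMem _ hq⟩
    simp only [D, Equiv.apply_symm_apply]
    rw [if_pos hq', hgap.cantorLeft_eq hq, hgap.cantorRight_eq hq]
    exact Ioo_subset_Icc_self hmem
  · cases n with
    | zero => exact cantorSet_subset_unitInterval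
    | succ m =>
      simp only [D]
      split_ifs with h
      · exact (exists_isCantorGap h.1 h.2).2.Icc_subset
      · exact empty_subset _
  · cases n with
    | zero =>
      refine isACOn_of_lipschitz (K := 0) fun x hx y hy => ?_
      rw [cantorBump_of_mem hx, cantorBump_of_mem hy]; simp
    | succ m =>
      simp only [D]
      split_ifs with h
      · exact (exists_isCantorGap h.1 h.2).2.isACOn_cantorBump
      · exact isACOn_of_lipschitz (K := 0) (by simp)

/-- Near the interior point `x` the set contains every point but `x`, so the density quotient is
eventually equal to 1. Measurability comes from continuity of the quotient off `x`. -/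
theorem hasApproxDerivAt_of_hasDerivAt {a b : ℝ} {F : ℝ → ℝ} {α x : ℝ}
    (hF : ContinuousOn F (Icc a b)) (hx : x ∈ Ioo a b) (h : HasDerivAt F α x) :
    HasApproxDerivAt a b F α x := by
  intro ε hε
  refine ⟨MeasurableSet.nullMeasurableSet ?_, ?_⟩
  · have hc : ContinuousOn (fun y => |(F y - F x) / (y - x) - α|) (Icc a b \ {x}) := by
      refine ContinuousOn.abs (ContinuousOn.sub (ContinuousOn.div ?_ (by fun_prop) ?_)
        continuousOn_const)
      · exact (hF.mono sdiff_subset).sub continuousOn_const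
      · intro y hy
        exact sub_ne_zero.2 hy.2
    have hm : MeasurableSet (Icc a b \ {x}) := measurableSet_Icc.diff (measurableSet_singleton x)
    obtain ⟨U, hU, hUe⟩ := (continuousOn_iff'.1 hc) (Iio ε) isOpen_Iio
    have hset : {y ∈ Icc a b | y ≠ x ∧ |(F y - F x) / (y - x) - α| < ε}
        = U ∩ (Icc a b \ {x}) := by
      rw [← hUe]
      ext y
      simp only [mem_ofPred_eq, mem_inter_iff, mem_preimage, mem_Iio, Set.mem_sdiff, mem_singleton_iff]
      tauto
    rw [hset]
    exact hU.measurableSet.inter hm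
  · have hev : ∀ᶠ y in 𝓝[≠] x, |(F y - F x) / (y - x) - α| < ε := by
      have := (hasDerivAt_iff_tendsto_slope.1 h)
      have := (tendsto_order.1 ((this.sub_const α).abs)).2 ε (by simpa using hε)
      filter_upwards [this] with y hy
      rwa [slope_def_field] at hy
    have hev' : ∀ᶠ y in 𝓝 x, y ≠ x → y ∈ Icc a b ∧ |(F y - F x) / (y - x) - α| < ε := by
      filter_upwards [eventually_nhdsWithin_iff.1 hev, Icc_mem_nhds hx.1 hx.2] with y h1 h2 h3
      exact ⟨h2, h1 h3⟩
    obtain ⟨d, hd, hball⟩ := Metric.eventually_nhds_iff.1 hev'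
    refine (tendsto_const_nhds (x := (1 : ℝ))).congr' ?_
    filter_upwards [Ioo_mem_nhdsGT hd] with s hs
    have hset : {y ∈ Icc a b | y ≠ x ∧ |(F y - F x) / (y - x) - α| < ε} ∩ Icc (x - s) (x + s)
        = Icc (x - s) (x + s) \ {x} := by
      ext y
      simp only [mem_inter_iff, mem_ofPred_eq, Set.mem_sdiff, mem_singleton_iff]
      constructor
      · rintro ⟨⟨-, h1, -⟩, h2⟩; exact ⟨h2, h1⟩
      · rintro ⟨h2, h1⟩
        have hdist : dist y x < d := by
          rw [Real.dist_eq]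
          exact (abs_le.2 ⟨by linarith [h2.1], by linarith [h2.2]⟩ : |y - x| ≤ s).trans_lt hs.2
        obtain ⟨h3, h4⟩ := hball hdist h1
        exact ⟨⟨h3, h1, h4⟩, h2⟩
    rw [hset, measureReal_def, measure_sdiff_null (by simp), Real.volume_Icc,
      ENNReal.toReal_ofReal (by linarith [hs.1])]
    have := hs.1
    field_simp
    ring

/-! ### A maximum principle for second differences -/

/-- At an interior maximum of `N` minus its chord all small second differences would be nonpositive.
One good step `s` below each `d` suffices. -/
theorem le_chord_of_exists_second_difference_pos {u v : ℝ} (huv : u < v) {N : ℝ → ℝ}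
    (hN : ContinuousOn N (Icc u v))
    (h : ∀ x ∈ Ioo u v, ∀ d > 0, ∃ s ∈ Ioo 0 d, 0 < N (x + s) + N (x - s) - 2 * N x)
    {x : ℝ} (hx : x ∈ Icc u v) : N x ≤ N u + (N v - N u) / (v - u) * (x - u) := by
  set m := (N v - N u) / (v - u) with hm
  have hmv : m * (v - u) = N v - N u := div_mul_cancel₀ _ (sub_pos.2 huv).ne'
  set g : ℝ → ℝ := fun y => N y - (N u + m * (y - u)) with hg
  have hgc : ContinuousOn g (Icc u v) := hN.sub (by fun_prop)
  obtain ⟨x₀, hx₀, hmax⟩ := isCompact_Icc.exists_isMaxOn ⟨x, hx⟩ hgc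
  by_contra! hlt
  have hgx : 0 < g x₀ := lt_of_lt_of_le (by simp only [hg]; linarith) (hmax hx)
  have hu : x₀ ≠ u := by rintro rfl; simp [hg] at hgx
  have hv : x₀ ≠ v := by rintro rfl; simp only [hg] at hgx; linarith
  have h1 : u < x₀ := lt_of_le_of_ne hx₀.1 hu.symm
  have h2 : x₀ < v := lt_of_le_of_ne hx₀.2 hv
  obtain ⟨s, hs, hpos⟩ := h x₀ ⟨h1, h2⟩ (min (x₀ - u) (v - x₀))
    (lt_min (sub_pos.2 h1) (sub_pos.2 h2))
  have hs1 := lt_min_iff.1 hs.2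
  have m1 : g (x₀ + s) ≤ g x₀ := hmax ⟨by linarith [hs.1], by linarith [hs1.2]⟩
  have m2 : g (x₀ - s) ≤ g x₀ := hmax ⟨by linarith [hs1.1], by linarith [hs.1]⟩
  simp only [hg] at m1 m2
  have : m * (x₀ + s - u) + m * (x₀ - s - u) = 2 * (m * (x₀ - u)) := by ring
  linarith

/-- Otherwise iterated halving from `s₀ = d / 2` gives `4 ^ k * w (s₀ / 2 ^ k) ≤ w s₀`, while the
term `η * s` keeps `w (s₀ / 2 ^ k)` above `η * s₀ / 2 ^ k`; then `2 ^ k * η * s₀ ≤ w s₀` for all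
`k`. -/
theorem exists_lt_four_mul_half {w : ℝ → ℝ} (hw : ∀ s, 0 ≤ s → 0 ≤ w s) {d η : ℝ} (hd : 0 < d)
    (hη : 0 < η) : ∃ s ∈ Ioo 0 d, w s < 4 * w (s / 2) + η * s := by
  by_contra! h
  have hs₀ : 0 < d / 2 := by linarith
  have hk : ∀ k : ℕ, d / 2 / 2 ^ k ∈ Ioo 0 d := fun k =>
    ⟨by positivity, (div_le_self hs₀.le (one_le_pow₀ (by norm_num))).trans_lt (by linarith)⟩
  have h4 : ∀ k : ℕ, 4 ^ k * w (d / 2 / 2 ^ k) ≤ w (d / 2) := by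
    intro k
    induction k with
    | zero => simp
    | succ k ih =>
      have := h _ (hk k)
      have h0 := (hk k).1
      rw [show d / 2 / 2 ^ (k + 1) = d / 2 / 2 ^ k / 2 by rw [pow_succ]; field_simp]
      refine le_trans ?_ ih
      rw [pow_succ, mul_assoc]
      gcongr
      have : 0 < η * (d / 2 / 2 ^ k) := by positivity
      linarith
  have h2 : ∀ k : ℕ, 2 ^ k * (η * (d / 2)) ≤ w (d / 2) := by
    intro k
    refine le_trans ?_ (h4 k)
    have h5 := h _ (hk k)
    have h6 := hw (d / 2 / 2 ^ k / 2) (by positivity)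
    calc 2 ^ k * (η * (d / 2)) = 4 ^ k * (η * (d / 2 / 2 ^ k)) := by
          rw [show (4 : ℝ) ^ k = 2 ^ k * 2 ^ k by rw [← mul_pow]; norm_num]; field_simp
      _ ≤ _ := by gcongr; linarith
  obtain ⟨k, hk'⟩ := pow_unbounded_of_one_lt (w (d / 2) / (η * (d / 2))) (one_lt_two)
  rw [div_lt_iff₀ (by positivity)] at hk'
  exact absurd (h2 k) (not_le.2 hk')

theorem le_integral_second_difference_of_monotone {Φ : ℝ → ℝ} (hΦ : Monotone Φ) (x : ℝ) {s : ℝ}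
    (hs : 0 < s) :
    s / 2 * (Φ (x + s / 2) - Φ (x - s / 2)) ≤ (∫ y in x..(x + s), Φ y) - ∫ y in (x - s)..x, Φ y := by
  have hi : ∀ a b, IntervalIntegrable Φ volume a b := fun a b => hΦ.intervalIntegrable
  have lower : ∀ a b, a ≤ b → (b - a) * Φ a ≤ ∫ y in a..b, Φ y := by
    intro a b hab
    have := intervalIntegral.integral_mono_on hab intervalIntegrable_const (hi a b)
      (fun y hy => hΦ hy.1)
    simpa using this
  have upper : ∀ a b, a ≤ b → ∫ y in a..b, Φ y ≤ (b - a) * Φ b := by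
    intro a b hab
    have := intervalIntegral.integral_mono_on hab (hi a b) intervalIntegrable_const
      (fun y hy => hΦ hy.2)
    simpa using this
  have e1 := intervalIntegral.integral_add_adjacent_intervals (hi x (x + s / 2))
    (hi (x + s / 2) (x + s))
  have e2 := intervalIntegral.integral_add_adjacent_intervals (hi (x - s) (x - s / 2))
    (hi (x - s / 2) x)
  have l1 := lower x (x + s / 2) (by linarith)
  have l2 := lower (x + s / 2) (x + s) (by linarith)
  have l3 := upper (x - s) (x - s / 2) (by linarith)
  have l4 := upper (x - s / 2) x (by linarith)
  rw [← e1, ← e2]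
  ring_nf at l1 l2 l3 l4 ⊢
  linarith

/-- The possible concavity of `M` is offset by a multiple of the primitive `ψ` of `Φ`, whose total
size is at most `ε * (v - u)`, and by a small parabola. -/
theorem le_chord_add_of_second_difference {u v ε : ℝ} (huv : u < v) {M Φ : ℝ → ℝ}
    (hM : ContinuousOn M (Icc u v)) (hΦ : Monotone Φ) (h0 : ∀ x, 0 ≤ Φ x) (h1 : ∀ x, Φ x ≤ ε)
    (h : ∀ x ∈ Ioo u v, ∀ η > 0, ∃ d > 0, ∀ s ∈ Ioo 0 d,
      -(s * (Φ (x + s) - Φ (x - s)) + η * s ^ 2) ≤ M (x + s) + M (x - s) - 2 * M x)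
    {x : ℝ} (hx : x ∈ Icc u v) :
    M x ≤ M u + (M v - M u) / (v - u) * (x - u) + 8 * (ε * (v - u)) := by
  have hi : ∀ a b, IntervalIntegrable Φ volume a b := fun a b => hΦ.intervalIntegrable
  have huv' := sub_pos.2 huv
  set ψ : ℝ → ℝ := fun y => ∫ t in u..y, Φ t with hψ
  have hψc : Continuous ψ := intervalIntegral.continuous_primitive hi u
  refine le_of_forall_pos_le_add fun η' hη' => ?_
  set η := η' / (v - u) ^ 2 with hηdef
  have hη : 0 < η := by positivity
  -- With `w s = Φ (y + s) - Φ (y - s)`, the second difference of `8 * ψ` is at least `4 * s * w (s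
  -- / 2)` and that of the parabola is `2 * η * s ^ 2`. Against the loss `s * w s + η * s ^ 2`, the
  -- total is positive whenever `w s < 4 * w (s / 2) + η * s`.
  set N : ℝ → ℝ := fun y => M y + 8 * ψ y + η * (y - u) ^ 2 with hNdef
  have key := le_chord_of_exists_second_difference_pos huv (N := N)
    ((hM.add (by fun_prop)).add (by fun_prop)) ?_ hx
  · have hψu : ψ u = 0 := by simp [hψ]
    have hψx : 0 ≤ ψ x := intervalIntegral.integral_nonneg hx.1 fun y _ => h0 y
    have hψv : ψ v ≤ ε * (v - u) := by
      have := intervalIntegral.integral_mono_on huv.le (hi u v) intervalIntegrable_const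
        (fun y _ => h1 y)
      simpa [mul_comm] using this
    have hψv0 : 0 ≤ ψ v := intervalIntegral.integral_nonneg huv.le fun y _ => h0 y
    have hηv : η * (v - u) ^ 2 = η' := by rw [hηdef]; field_simp
    set t := (x - u) / (v - u) with ht
    have ht0 : 0 ≤ t := div_nonneg (sub_nonneg.2 hx.1) huv'.le
    have ht1 : t ≤ 1 := (div_le_one huv').2 (by linarith [hx.2])
    have e : ∀ z : ℝ, z / (v - u) * (x - u) = z * t := fun z => by rw [ht]; ring
    rw [e] at key ⊢
    simp only [hNdef] at key
    rw [hψu] at key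
    have b1 : ψ v * t ≤ ε * (v - u) := (mul_le_of_le_one_right hψv0 ht1).trans hψv
    have b2 : η' * t ≤ η' := mul_le_of_le_one_right hη'.le ht1
    have b3 : 0 ≤ η * (x - u) ^ 2 := by positivity
    rw [hηv] at key
    have e2 : (M v + 8 * ψ v + η' - (M u + 8 * 0 + η * (u - u) ^ 2)) * t
      = (M v - M u) * t + 8 * (ψ v * t) + η' * t := by ring
    rw [e2] at key
    linarith
  · intro y hy d hd
    obtain ⟨d', hd', hstep⟩ := h y hy η hη
    obtain ⟨s, hs, hlt⟩ := exists_lt_four_mul_half (w := fun s => Φ (y + s) - Φ (y - s))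
      (fun s hs => sub_nonneg.2 (hΦ (by linarith))) (lt_min hd hd') hη
    have hs' := lt_min_iff.1 hs.2
    refine ⟨s, ⟨hs.1, hs'.1⟩, ?_⟩
    have a1 := hstep s ⟨hs.1, hs'.2⟩
    have a2 := le_integral_second_difference_of_monotone hΦ y hs.1
    have e1 := intervalIntegral.integral_add_adjacent_intervals (hi u y) (hi y (y + s))
    have e2 := intervalIntegral.integral_add_adjacent_intervals (hi u (y - s)) (hi (y - s) y)
    have a3 := mul_lt_mul_of_pos_left hlt hs.1
    have hq : 0 < η * s ^ 2 := by have := hs.1; positivity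
    have e3 : (y + s - u) ^ 2 + (y - s - u) ^ 2 = 2 * (y - u) ^ 2 + 2 * s ^ 2 := by ring
    simp only [hNdef, hψ]
    have e4 : η * (y + s - u) ^ 2 + η * (y - s - u) ^ 2 = 2 * (η * (y - u) ^ 2) + 2 * (η * s ^ 2) := by
      ring
    ring_nf at a1 a2 a3 e4 e1 e2 hq ⊢
    linarith

/-! ### Uniqueness of the primitive in the mean -/

variable {a b : ℝ}

theorem IsDivision.cons {I : TaggedInterval a b} {q : ℕ} {J : Fin q → TaggedInterval a b}
    (hJ : IsDivision J) (h : ∀ i, (J i).right ≤ I.left) :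
    IsDivision (Fin.cons I J : Fin (q + 1) → TaggedInterval a b) := by
  have key : ∀ i, Disjoint (Ioo (J i).left (J i).right) (Ioo I.left I.right) := fun i =>
    Set.disjoint_left.2 fun y h1 h2 => by linarith [h1.2, h2.1, h i]
  intro i j hij
  cases i using Fin.cases with
  | zero =>
    cases j using Fin.cases with
    | zero => exact absurd rfl hij
    | succ j => exact (key j).symm
  | succ i =>
    cases j using Fin.cases with
    | zero => exact key i
    | succ j => exact hJ i j fun h => hij (by rw [h])

/-- The supremum of the sums of `D` over the `δ`-fine divisions lying on the left of `x`. -/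
noncomputable def fineVariation (D : TaggedInterval a b → ℝ) (δ : ℝ → ℝ) (x : ℝ) : ℝ :=
  sSup {S | ∃ (q : ℕ) (I : Fin q → TaggedInterval a b), IsDivision I ∧ (∀ i, (I i).IsFine δ) ∧
    (∀ i, (I i).right ≤ x) ∧ S = ∑ i, D (I i)}

section fineVariation

variable {D : TaggedInterval a b → ℝ} {δ : ℝ → ℝ} {ε : ℝ}

theorem fineVariation_nonempty (x : ℝ) :
    {S | ∃ (q : ℕ) (I : Fin q → TaggedInterval a b), IsDivision I ∧ (∀ i, (I i).IsFine δ) ∧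
      (∀ i, (I i).right ≤ x) ∧ S = ∑ i, D (I i)}.Nonempty :=
  ⟨0, 0, Fin.elim0, fun i => i.elim0, fun i => i.elim0, fun i => i.elim0, by simp⟩

theorem sum_le_fineVariation
    (hD : ∀ (q : ℕ) (I : Fin q → TaggedInterval a b), IsDivision I → (∀ i, (I i).IsFine δ) →
    ∑ i, D (I i) ≤ ε) {x : ℝ} {q : ℕ} {I : Fin q → TaggedInterval a b}
    (hI : IsDivision I) (hf : ∀ i, (I i).IsFine δ) (hx : ∀ i, (I i).right ≤ x) :
    ∑ i, D (I i) ≤ fineVariation D δ x :=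
  le_csSup ⟨ε, by rintro _ ⟨q, J, hJ, hJf, -, rfl⟩; exact hD q J hJ hJf⟩ ⟨q, I, hI, hf, hx, rfl⟩

theorem fineVariation_nonneg
    (hD : ∀ (q : ℕ) (I : Fin q → TaggedInterval a b), IsDivision I → (∀ i, (I i).IsFine δ) →
    ∑ i, D (I i) ≤ ε) (x : ℝ) : 0 ≤ fineVariation D δ x := by
  simpa using sum_le_fineVariation hD (x := x) (I := Fin.elim0) (fun i => i.elim0)
    (fun i => i.elim0) (fun i => i.elim0)

theorem fineVariation_le
    (hD : ∀ (q : ℕ) (I : Fin q → TaggedInterval a b), IsDivision I → (∀ i, (I i).IsFine δ) →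
    ∑ i, D (I i) ≤ ε) (x : ℝ) : fineVariation D δ x ≤ ε :=
  csSup_le (fineVariation_nonempty x) (by rintro _ ⟨q, J, hJ, hJf, -, rfl⟩; exact hD q J hJ hJf)

theorem monotone_fineVariation
    (hD : ∀ (q : ℕ) (I : Fin q → TaggedInterval a b), IsDivision I → (∀ i, (I i).IsFine δ) →
    ∑ i, D (I i) ≤ ε) : Monotone (fineVariation D δ) := fun x y hxy =>
  csSup_le (fineVariation_nonempty x) (by
    rintro _ ⟨q, J, hJ, hJf, hJx, rfl⟩
    exact sum_le_fineVariation hD hJ hJf fun i => (hJx i).trans hxy)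

/-- A fine division left of `I` stays one when `I` is appended, so the variation grows by at least
`D I` across `I`. -/
theorem fineVariation_add_le
    (hD : ∀ (q : ℕ) (I : Fin q → TaggedInterval a b), IsDivision I → (∀ i, (I i).IsFine δ) →
    ∑ i, D (I i) ≤ ε) {I : TaggedInterval a b} (hI : I.IsFine δ) :
    D I ≤ fineVariation D δ I.right - fineVariation D δ I.left := by
  rw [le_sub_comm]
  refine csSup_le (fineVariation_nonempty _) ?_
  rintro _ ⟨q, J, hJ, hJf, hJx, rfl⟩
  rw [le_sub_iff_add_le, add_comm]
  have := sum_le_fineVariation hD (x := I.right) (hJ.cons hJx)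
    (Fin.cases (by simpa using hI) (by simpa using hJf))
    (Fin.cases (by simp) (by simpa using fun i => (hJx i).trans I.left_lt_right.le))
  simpa [Fin.sum_univ_succ] using this

end fineVariation

/-- The mean deviation of `G` from its first order expansion at the tag with slope `f`. -/
noncomputable def meanDeviation (G f : ℝ → ℝ) (I : TaggedInterval a b) : ℝ :=
  (1 / (I.right - I.left)) *
    ∫ y in I.left..I.right, |G y - G I.tag - f I.tag * (y - I.tag)|

theorem intervalIntegrable_of_mem_Icc {G : ℝ → ℝ} (hG : IntegrableOn G (Icc a b)) {c d : ℝ}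
    (hc : c ∈ Icc a b) (hd : d ∈ Icc a b) : IntervalIntegrable G volume c d := by
  rw [intervalIntegrable_iff]
  exact hG.mono_set (uIoc_subset_uIcc.trans (uIcc_subset_Icc hc hd))

/-- The two expansions share the slope `f I.tag`, so the linear terms cancel in the difference. -/
theorem abs_integral_sub_le_meanDeviation {G F f : ℝ → ℝ} (hG : IntegrableOn G (Icc a b))
    (hF : IntegrableOn F (Icc a b)) (I : TaggedInterval a b) {η : ℝ}
    (hη : ∀ y ∈ Icc I.left I.right, |F y - F I.tag - f I.tag * (y - I.tag)| ≤ η) :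
    |(∫ y in I.left..I.right, (G y - F y)) - (I.right - I.left) * (G I.tag - F I.tag)|
      ≤ (I.right - I.left) * (meanDeviation G f I + η) := by
  have hlr := I.left_lt_right
  have hl : I.left ∈ Icc a b := ⟨I.a_le_left, hlr.le.trans I.right_le_b⟩
  have hr : I.right ∈ Icc a b := ⟨I.a_le_left.trans hlr.le, I.right_le_b⟩
  have iG := intervalIntegrable_of_mem_Icc hG hl hr
  have iF := intervalIntegrable_of_mem_Icc hF hl hr
  set x := I.tag
  have iL : IntervalIntegrable (fun y => f x * (y - x)) volume I.left I.right :=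
    Continuous.intervalIntegrable (by fun_prop) _ _
  have i1 : IntervalIntegrable (fun y => G y - G x - f x * (y - x)) volume I.left I.right :=
    (iG.sub intervalIntegrable_const).sub iL
  have i2 : IntervalIntegrable (fun y => F y - F x - f x * (y - x)) volume I.left I.right :=
    (iF.sub intervalIntegrable_const).sub iL
  have e : (∫ y in I.left..I.right, (G y - F y)) - (I.right - I.left) * (G x - F x)
      = (∫ y in I.left..I.right, (G y - G x - f x * (y - x)))
        - ∫ y in I.left..I.right, (F y - F x - f x * (y - x)) := by
    rw [← intervalIntegral.integral_sub i1 i2]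
    have : (I.right - I.left) * (G x - F x) = ∫ _ in I.left..I.right, (G x - F x) := by
      rw [intervalIntegral.integral_const, smul_eq_mul]
    rw [this, ← intervalIntegral.integral_sub (iG.sub iF) intervalIntegrable_const]
    congr 1
    ext y
    ring
  have b1 := intervalIntegral.abs_integral_le_integral_abs (μ := volume) hlr.le
    (f := fun y => G y - G x - f x * (y - x))
  have b2 := intervalIntegral.norm_integral_le_of_norm_le_const (a := I.left) (b := I.right)
    (f := fun y => F y - F x - f x * (y - x)) (C := η) (by
      intro y hy
      rw [uIoc_of_le hlr.le] at hy
      exact hη y (Ioc_subset_Icc_self hy))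
  rw [abs_of_pos (sub_pos.2 hlr), Real.norm_eq_abs] at b2
  have e2 : (I.right - I.left) * meanDeviation G f I
      = ∫ y in I.left..I.right, |G y - G x - f x * (y - x)| := by
    have := (sub_pos.2 hlr).ne'
    rw [meanDeviation]
    field_simp
    rfl
  rw [e, mul_add, e2]
  have b3 := abs_sub (∫ y in I.left..I.right, (G y - G x - f x * (y - x)))
    (∫ y in I.left..I.right, (F y - F x - f x * (y - x)))
  linarith

/-- Linearity of the integral expresses that `G - F` is a.e. constant on the gap. The variation of
the mean deviations serves as the monotone `Φ` controlling second differences of the integral. -/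
theorem integral_sub_eq_of_meanDeviation {G F f : ℝ → ℝ} (hG : IntegrableOn G (Icc a b))
    (hF : IntegrableOn F (Icc a b))
    (H : ∀ ε > 0, ∃ δ : ℝ → ℝ, IsGaugeOn δ (Icc a b) ∧
      ∀ (q : ℕ) (I : Fin q → TaggedInterval a b), IsDivision I → (∀ i, (I i).IsFine δ) →
        ∑ i, meanDeviation G f (I i) ≤ ε)
    {u v : ℝ} (huv : u < v) (hsub : Icc u v ⊆ Icc a b)
    (hder : ∀ x ∈ Ioo u v, HasDerivAt F (f x) x) {x : ℝ} (hx : x ∈ Icc u v) :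
    ∫ y in u..x, (G y - F y) = (∫ y in u..v, (G y - F y)) / (v - u) * (x - u) := by
  have huI : u ∈ Icc u v := left_mem_Icc.2 huv.le
  have hvI : v ∈ Icc u v := right_mem_Icc.2 huv.le
  have hint : ∀ c ∈ Icc u v, ∀ d ∈ Icc u v,
      IntervalIntegrable (fun y => G y - F y) volume c d := fun c hc d hd =>
    intervalIntegrable_of_mem_Icc (hG.sub hF) (hsub hc) (hsub hd)
  set M : ℝ → ℝ := fun z => ∫ y in u..z, (G y - F y) with hM
  have hMu : M u = 0 := by simp [hM]
  have hMc : ContinuousOn M (Icc u v) := by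
    have := intervalIntegral.continuousOn_primitive_interval (a := u) (b := v)
      (f := fun y => G y - F y) (μ := volume) (by
        rw [uIcc_of_le huv.le]; exact (hG.sub hF).mono_set hsub)
    rwa [uIcc_of_le huv.le] at this
  have hdiff : ∀ c ∈ Icc u v, ∀ d ∈ Icc u v, M d - M c = ∫ y in c..d, (G y - F y) := by
    intro c hc d hd
    rw [hM, sub_eq_iff_eq_add']
    exact (intervalIntegral.integral_add_adjacent_intervals (hint u huI c hc)
      (hint c hc d hd)).symm
  have key : ∀ ε > 0, ∃ Φ : ℝ → ℝ, Monotone Φ ∧ (∀ x, 0 ≤ Φ x) ∧ (∀ x, Φ x ≤ ε) ∧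
      ∀ x ∈ Ioo u v, ∀ η > 0, ∃ d > 0, ∀ s ∈ Ioo 0 d,
        |M (x + s) + M (x - s) - 2 * M x| ≤ s * (Φ (x + s) - Φ (x - s)) + η * s ^ 2 := by
    intro ε hε
    obtain ⟨δ, hδ, hsum⟩ := H ε hε
    refine ⟨fineVariation (meanDeviation G f) δ, monotone_fineVariation hsum,
      fineVariation_nonneg hsum, fineVariation_le hsum, fun x hx η hη => ?_⟩
    have hev := (hasDerivAt_iff_isLittleO.1 (hder x hx)).def (half_pos hη)
    obtain ⟨dF, hdF, hball⟩ := Metric.eventually_nhds_iff.1 hev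
    have hxI := Ioo_subset_Icc_self hx
    have hδx := hδ x (hsub hxI)
    refine ⟨min (min (δ x) dF) (min (x - u) (v - x)), lt_min (lt_min hδx hdF)
      (lt_min (sub_pos.2 hx.1) (sub_pos.2 hx.2)), fun s hs => ?_⟩
    obtain ⟨⟨s1, s2⟩, s3, s4⟩ : (s < δ x ∧ s < dF) ∧ s < x - u ∧ s < v - x := by
      simpa only [lt_min_iff] using hs.2
    have s0 := hs.1
    have hF' : ∀ y, |y - x| ≤ s → |F y - F x - f x * (y - x)| ≤ η / 2 * s := by
      intro y hy
      have := hball (y := y) (by rw [Real.dist_eq]; linarith)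
      rw [Real.norm_eq_abs, Real.norm_eq_abs, smul_eq_mul, mul_comm (y - x)] at this
      exact this.trans (by gcongr)
    have hl : x - s ∈ Icc u v := ⟨by linarith, by linarith⟩
    have hr : x + s ∈ Icc u v := ⟨by linarith, by linarith⟩
    -- Both halves of `[x - s, x + s]` are tagged at `x`, so `s * (G x - F x)` cancels in the second
    -- difference.
    let R : TaggedInterval a b :=
      ⟨x, x + s, x, (hsub hxI).1, by linarith, (hsub hr).2, ⟨le_rfl, by linarith⟩⟩
    let L : TaggedInterval a b :=
      ⟨x - s, x, x, (hsub hl).1, by linarith, (hsub hxI).2, ⟨by linarith, le_rfl⟩⟩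
    have fR : R.IsFine δ := fun y hy => by
      have h1 : x ≤ y := hy.1
      have h2 : y ≤ x + s := hy.2
      exact ⟨show x - δ x < y by linarith, show y < x + δ x by linarith⟩
    have fL : L.IsFine δ := fun y hy => by
      have h1 : x - s ≤ y := hy.1
      have h2 : y ≤ x := hy.2
      exact ⟨show x - δ x < y by linarith, show y < x + δ x by linarith⟩
    have bR := abs_integral_sub_le_meanDeviation (f := f) hG hF R (η := η / 2 * s) fun y hy => by
      have h1 : x ≤ y := hy.1
      have h2 : y ≤ x + s := hy.2
      exact hF' y (abs_le.2 ⟨by linarith, by linarith⟩)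
    have bL := abs_integral_sub_le_meanDeviation (f := f) hG hF L (η := η / 2 * s) fun y hy => by
      have h1 : x - s ≤ y := hy.1
      have h2 : y ≤ x := hy.2
      exact hF' y (abs_le.2 ⟨by linarith, by linarith⟩)
    have vR := fineVariation_add_le hsum fR
    have vL := fineVariation_add_le hsum fL
    rw [show R.right - R.left = s from add_sub_cancel_left x s] at bR
    rw [show L.right - L.left = s from sub_sub_cancel x s] at bL
    change |(∫ y in x..(x + s), (G y - F y)) - s * (G x - F x)| ≤ _ at bR
    change |(∫ y in (x - s)..x, (G y - F y)) - s * (G x - F x)| ≤ _ at bL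
    rw [← hdiff x hxI _ hr] at bR
    rw [← hdiff _ hl x hxI] at bL
    have wR : s * meanDeviation G f R ≤ s * (fineVariation (meanDeviation G f) δ (x + s)
      - fineVariation (meanDeviation G f) δ x) := mul_le_mul_of_nonneg_left vR s0.le
    have wL : s * meanDeviation G f L ≤ s * (fineVariation (meanDeviation G f) δ x
      - fineVariation (meanDeviation G f) δ (x - s)) := mul_le_mul_of_nonneg_left vL s0.le
    have hη2 : s * (η / 2 * s) = η * s ^ 2 / 2 := by ring
    rw [mul_add, hη2] at bR bL
    rw [mul_sub] at wR wL ⊢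
    rw [abs_le] at bR bL ⊢
    constructor <;> linarith [bR.1, bR.2, bL.1, bL.2]
  have hbound : ∀ ε > 0, |M x - (M u + (M v - M u) / (v - u) * (x - u))| ≤ ε := by
    intro ε hε
    have huv' := sub_pos.2 huv
    obtain ⟨Φ, m, h0, h1, hΦ⟩ := key (ε / (8 * (v - u))) (by positivity)
    have e : 8 * (ε / (8 * (v - u)) * (v - u)) = ε := by field_simp
    have c1 := le_chord_add_of_second_difference huv hMc m h0 h1 (fun y hy η hη => by
      obtain ⟨d, hd, hs⟩ := hΦ y hy η hη
      exact ⟨d, hd, fun s hs' => (abs_le.1 (hs s hs')).1⟩) hx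
    have c2 := le_chord_add_of_second_difference huv hMc.neg m h0 h1 (fun y hy η hη => by
      obtain ⟨d, hd, hs⟩ := hΦ y hy η hη
      refine ⟨d, hd, fun s hs' => ?_⟩
      have := (abs_le.1 (hs s hs')).2
      simp only [Pi.neg_apply]
      linarith) hx
    rw [e] at c1 c2
    simp only [Pi.neg_apply] at c2
    have e2 : (-M v - -M u) / (v - u) * (x - u) = -((M v - M u) / (v - u) * (x - u)) := by ring
    rw [e2] at c2
    exact abs_le.2 ⟨by linarith, by linarith⟩
  have := abs_nonpos_iff.1 (le_of_forall_pos_le_add (fun ε hε => by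
    simpa using hbound ε hε) : |M x - (M u + (M v - M u) / (v - u) * (x - u))| ≤ 0)
  rw [hMu] at this
  simp only [hM, zero_add, sub_zero] at this ⊢
  exact sub_eq_zero.1 this

/-! ### Large sums of mean oscillations on the Cantor set -/

theorem integral_gapBump {u v : ℝ} (x : ℝ) :
    ∫ y in u..x, gapBump u v y
      = ((v - u) * (x - u) ^ 2 / 2 - (x - u) ^ 3 / 3) / ((v - u) * √(v - u)) := by
  have hd : ∀ y, HasDerivAt (fun y : ℝ =>
      ((v - u) * (y - u) ^ 2 / 2 - (y - u) ^ 3 / 3) / ((v - u) * √(v - u))) (gapBump u v y) y := by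
    intro y
    have h1 := (hasDerivAt_id y).sub_const u
    have := (((h1.pow 2).const_mul (v - u)).div_const 2 |>.sub ((h1.pow 3).div_const 3)).div_const
      ((v - u) * √(v - u))
    refine this.congr_deriv ?_
    simp only [gapBump, id]
    push_cast
    ring
  rw [intervalIntegral.integral_eq_sub_of_hasDerivAt (fun y _ => hd y)
    ((continuous_gapBump u v).intervalIntegrable _ _)]
  simp

/-- Test `G - c` against the function equal to 1 on the middle half and -1 on the outer quarters.
Constants integrate to zero against it, so neither `κ` nor `c` matters, and the parabola contributes
exactly `L * √L / 16`. -/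
theorem le_integral_abs_sub {G : ℝ → ℝ} {u v κ : ℝ} (huv : u < v)
    (hG : IntegrableOn G (Icc u v))
    (h : ∀ x ∈ Icc u v, ∫ y in u..x, (G y - gapBump u v y) = κ * (x - u)) (c : ℝ) :
    (v - u) * √(v - u) / 16 ≤ ∫ y in u..v, |G y - c| := by
  set L := v - u with hL
  have hL0 : 0 < L := sub_pos.2 huv
  have huI : u ∈ Icc u v := left_mem_Icc.2 huv.le
  have hvI : v ∈ Icc u v := right_mem_Icc.2 huv.le
  have hpI : u + L / 4 ∈ Icc u v := ⟨by linarith, by linarith⟩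
  have hqI : u + 3 * L / 4 ∈ Icc u v := ⟨by linarith, by linarith⟩
  have iG : ∀ x ∈ Icc u v, ∀ y ∈ Icc u v, IntervalIntegrable G volume x y :=
    fun x hx y hy => intervalIntegrable_of_mem_Icc hG hx hy
  have ig : ∀ x ∈ Icc u v, ∀ y ∈ Icc u v, IntervalIntegrable (fun y => G y - c) volume x y :=
    fun x hx y hy => (iG x hx y hy).sub intervalIntegrable_const
  have hE : ∀ x ∈ Icc u v, ∫ y in u..x, (G y - c)
      = (κ - c) * (x - u) + (L * (x - u) ^ 2 / 2 - (x - u) ^ 3 / 3) / (L * √L) := by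
    intro x hx
    have hb : IntervalIntegrable (gapBump u v) volume u x :=
      (continuous_gapBump u v).intervalIntegrable _ _
    have e1 := h x hx
    rw [intervalIntegral.integral_sub (iG u huI x hx) hb, integral_gapBump] at e1
    rw [intervalIntegral.integral_sub (iG u huI x hx) intervalIntegrable_const,
      intervalIntegral.integral_const, smul_eq_mul, sub_eq_iff_eq_add.1 e1]
    ring
  have s1 := intervalIntegral.integral_add_adjacent_intervals (ig u huI _ hpI) (ig _ hpI _ hqI)
  have s2 := intervalIntegral.integral_add_adjacent_intervals (ig u huI _ hqI) (ig _ hqI v hvI)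
  have a1 := intervalIntegral.integral_add_adjacent_intervals (ig u huI _ hpI).abs
    (ig _ hpI _ hqI).abs
  have a2 := intervalIntegral.integral_add_adjacent_intervals (ig u huI _ hqI).abs
    (ig _ hqI v hvI).abs
  have b1 := (abs_le.1 (intervalIntegral.abs_integral_le_integral_abs (μ := volume) hpI.1
    (f := fun y => G y - c))).1
  have b2 := (abs_le.1 (intervalIntegral.abs_integral_le_integral_abs (μ := volume)
    (show u + L / 4 ≤ u + 3 * L / 4 by linarith) (f := fun y => G y - c))).2
  have b3 := (abs_le.1 (intervalIntegral.abs_integral_le_integral_abs (μ := volume) hqI.2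
    (f := fun y => G y - c))).1
  have Ep := hE _ hpI
  have Eq := hE _ hqI
  have Ev := hE _ hvI
  rw [show u + L / 4 - u = L / 4 by ring] at Ep
  rw [show u + 3 * L / 4 - u = 3 * L / 4 by ring] at Eq
  rw [← hL] at Ev
  have hs : 0 < √L := Real.sqrt_pos.2 hL0
  have fin : 2 * ((L * (3 * L / 4) ^ 2 / 2 - (3 * L / 4) ^ 3 / 3) / (L * √L))
      - 2 * ((L * (L / 4) ^ 2 / 2 - (L / 4) ^ 3 / 3) / (L * √L))
      - (L * L ^ 2 / 2 - L ^ 3 / 3) / (L * √L) = L * √L / 16 := by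
    field_simp
    rw [Real.sq_sqrt hL0.le]
    ring
  have lin : 2 * ((κ - c) * (3 * L / 4)) - 2 * ((κ - c) * (L / 4)) - (κ - c) * L = 0 := by ring
  linarith

/-- Baire's theorem in the compact space C, applied to the closures of the sets `δ > 1 / (n + 1)`.
-/
theorem exists_portion_of_gauge {δ : ℝ → ℝ} (hδ : IsGaugeOn δ cantorSet) :
    ∃ n : ℕ, ∃ x₀ ∈ cantorSet, ∃ ρ > 0, ∀ y ∈ cantorSet, |y - x₀| < ρ → ∀ ε > 0,
      ∃ x ∈ cantorSet, 1 / ((n : ℝ) + 1) < δ x ∧ |y - x| < ε := by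
  have : CompactSpace cantorSet := isCompact_iff_compactSpace.1 isCompact_cantorSet
  have : Nonempty cantorSet := ⟨⟨0, zero_mem_cantorSet⟩⟩
  obtain ⟨n, x₀, hx₀⟩ := nonempty_interior_of_iUnion_of_closed
    (f := fun n : ℕ => closure {x : cantorSet | 1 / ((n : ℝ) + 1) < δ x})
    (fun n => isClosed_closure) (by
      refine eq_univ_of_forall fun x => ?_
      obtain ⟨n, hn⟩ := exists_nat_one_div_lt (hδ x x.2)
      exact mem_iUnion.2 ⟨n, subset_closure hn⟩)
  obtain ⟨ρ, hρ, hball⟩ := Metric.isOpen_iff.1 isOpen_interior x₀ hx₀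
  refine ⟨n, x₀, x₀.2, ρ, hρ, fun y hy hyx ε hε => ?_⟩
  have hmem : (⟨y, hy⟩ : cantorSet) ∈ closure {x : cantorSet | 1 / ((n : ℝ) + 1) < δ x} :=
    interior_subset (hball (by simpa [Subtype.dist_eq, Real.dist_eq] using hyx))
  obtain ⟨x, hx, hd⟩ := Metric.mem_closure_iff.1 hmem ε hε
  exact ⟨x, x.2, hx, by simpa [Subtype.dist_eq, Real.dist_eq] using hd⟩

/-- Per level the number of gaps doubles while the bump height shrinks only by `√3`. -/
theorem eventually_le_two_pow_mul_sqrt (k : ℕ) (B : ℝ) :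
    ∀ᶠ j : ℕ in atTop, B ≤ 2 ^ j * (√(1 / 3 ^ (k + j + 1)) / 32) := by
  have hσ : 0 < √(1 / 3 : ℝ) := Real.sqrt_pos.2 (by norm_num)
  have h1 : 1 < 2 * √(1 / 3 : ℝ) := by
    have : (1 / 2 : ℝ) < √(1 / 3) := Real.lt_sqrt_of_sq_lt (by norm_num)
    linarith
  have ht := (tendsto_pow_atTop_atTop_of_one_lt h1).atTop_mul_const
    (show 0 < √(1 / 3 : ℝ) ^ (k + 1) / 32 by positivity)
  filter_upwards [ht.eventually_ge_atTop B] with j hj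
  refine hj.trans (le_of_eq ?_)
  have : √(1 / 3 ^ (k + j + 1)) = √(1 / 3 : ℝ) ^ (k + j + 1) := by
    rw [Real.sqrt_eq_iff_mul_self_eq (by positivity) (by positivity), ← mul_pow,
      Real.mul_self_sqrt (by norm_num), one_div_pow]
  rw [this, mul_pow]
  ring

theorem exists_fine_division_large {G : ℝ → ℝ} (hG : IntegrableOn G (Icc 0 1))
    (hgap : ∀ u v, IsCantorGap u v → ∀ c, (v - u) * √(v - u) / 16 ≤ ∫ y in u..v, |G y - c|)
    {δ : ℝ → ℝ} (hδ : IsGaugeOn δ cantorSet) (B : ℝ) :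
    ∃ (q : ℕ) (I : Fin q → TaggedInterval 0 1), IsDivision I ∧ (∀ i, (I i).IsFine δ) ∧
      (∀ i, (I i).tag ∈ cantorSet) ∧
      B ≤ ∑ i, (1 / ((I i).right - (I i).left)) *
        ∫ y in (I i).left..(I i).right, |G y - G (I i).tag| := by
  obtain ⟨n, x₀, hx₀, ρ, hρ, hdense⟩ := exists_portion_of_gauge hδ
  obtain ⟨k, hk⟩ := exists_pow_lt_of_lt_one hρ (show (1 / 3 : ℝ) < 1 by norm_num)
  obtain ⟨a, ha, hax⟩ := exists_cell_of_mem_cantorSet k hx₀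
  have hsmall : ∀ᶠ j : ℕ in atTop, 2 * (1 / 3 ^ (k + j + 1)) < 1 / ((n : ℝ) + 1) := by
    have h1 : Tendsto (fun j : ℕ => 2 * (1 / 3 : ℝ) ^ (j + (k + 1))) atTop (𝓝 (2 * 0)) :=
      ((tendsto_add_atTop_iff_nat (k + 1)).2
        (tendsto_pow_atTop_nhds_zero_of_lt_one (by norm_num) (by norm_num))).const_mul 2
    rw [mul_zero] at h1
    filter_upwards [(tendsto_order.1 h1).2 (1 / ((n : ℝ) + 1)) (by positivity)] with j hj
    rwa [one_div_pow, show j + (k + 1) = k + j + 1 by ring] at hj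
  obtain ⟨j, hj1, hj2⟩ := (hsmall.and (eventually_le_two_pow_mul_sqrt k B)).exists
  set L : ℝ := 1 / 3 ^ (k + j + 1) with hL
  have hL0 : 0 < L := by positivity
  have key : ∀ b : cantorCells j, ∃ J : TaggedInterval 0 1, J.IsFine δ ∧ J.tag ∈ cantorSet ∧
      ((3 ^ j * a + b : ℕ) : ℝ) / 3 ^ (k + j) ≤ J.left ∧
      J.right ≤ ((3 ^ j * a + b : ℕ) + 1 : ℝ) / 3 ^ (k + j) ∧
      √L / 32 ≤ (1 / (J.right - J.left)) * ∫ y in J.left..J.right, |G y - G J.tag| := by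
    rintro ⟨b, hb⟩
    simp only
    have hcell := cantorCells_add ha j hb
    set a' : ℕ := 3 ^ j * a + b with ha'
    have hg := isCantorGap_of_cell hcell
    set u : ℝ := (a' + 1 / 3) / 3 ^ (k + j) with hu
    set v : ℝ := (a' + 2 / 3) / 3 ^ (k + j) with hv
    have hLuv : v - u = L := by rw [hu, hv, hL, pow_succ]; field_simp; ring
    have e1 : (a' : ℝ) / 3 ^ (k + j) = u - L := by rw [hu, hL, pow_succ]; field_simp; ring
    have e2 : ((a' : ℝ) + 1) / 3 ^ (k + j) = v + L := by rw [hv, hL, pow_succ]; field_simp; ring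
    have hux : |u - x₀| < ρ := by
      refine lt_of_le_of_lt ?_ hk
      have hax' := cantorSet_subset_unitInterval hax
      have hb1 : (b : ℝ) + 1 ≤ 3 ^ j := by exact_mod_cast cantorCells_lt hb
      have hu' : 3 ^ k * u = a + (b + 1 / 3) / 3 ^ j := by
        rw [hu, ha', pow_add]; push_cast; field_simp; ring
      have hb2 : ((b : ℝ) + 1 / 3) / 3 ^ j ≤ 1 := (div_le_one (by positivity)).2 (by linarith)
      have hb3 : 0 ≤ ((b : ℝ) + 1 / 3) / 3 ^ j := by positivity
      have h3 : 3 ^ k * |u - x₀| ≤ 1 := by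
        have h3k : |(3 : ℝ) ^ k| = 3 ^ k := abs_of_pos (by positivity)
        rw [← h3k, ← abs_mul, mul_sub, hu']
        exact abs_le.2 ⟨by linarith [hax'.2], by linarith [hax'.1]⟩
      rw [one_div_pow, le_div_iff₀ (by positivity)]
      linarith
    obtain ⟨x, hxC, hxδ, hxu⟩ := hdense u hg.left_mem hux L hL0
    rw [abs_lt] at hxu
    -- The tag is within one gap length of `u` and not in the gap. Hence `[x, v]` covers the gap,
    -- has length below `2 * L`, and stays in its cell, which keeps different intervals
    -- non-overlapping.
    have hxu' : x ≤ u := not_lt.1 fun hlt => hg.notMem x ⟨hlt, by linarith⟩ hxC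
    have hxv : x < v := hxu'.trans_lt hg.lt
    have hx01 := cantorSet_subset_unitInterval hxC
    have hv01 := cantorSet_subset_unitInterval hg.right_mem
    refine ⟨⟨x, v, x, hx01.1, hxv, hv01.2, ⟨le_rfl, hxv.le⟩⟩, fun y hy => ?_, hxC, ?_, ?_, ?_⟩
    · have h1 : x ≤ y := hy.1
      have h2 : y ≤ v := hy.2
      have h3 := hδ x hxC
      exact ⟨show x - δ x < y by linarith, show y < x + δ x by linarith⟩
    · rw [e1]; linarith
    · rw [e2]; linarith
    · simp only
      have hmono : ∫ y in u..v, |G y - G x| ≤ ∫ y in x..v, |G y - G x| :=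
        intervalIntegral.integral_mono_interval hxu' hg.lt.le le_rfl
          (Eventually.of_forall fun y => abs_nonneg _)
          ((intervalIntegrable_of_mem_Icc hG hx01 hv01).sub intervalIntegrable_const).abs
      have h16 := (hgap u v hg (G x)).trans hmono
      rw [hLuv] at h16
      have hden : 0 < v - x := sub_pos.2 hxv
      rw [one_div_mul_eq_div, le_div_iff₀ hden]
      calc √L / 32 * (v - x) ≤ √L / 32 * (2 * L) := by gcongr; linarith
        _ = L * √L / 16 := by ring
        _ ≤ _ := h16
  choose J hJf hJt hJl hJr hJs using key
  let e := (cantorCells j).equivFinOfCardEq (card_cantorCells j)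
  have hsep : ∀ b c : cantorCells j, (b : ℕ) < c →
      Disjoint (Ioo (J b).left (J b).right) (Ioo (J c).left (J c).right) := by
    intro b c hbc
    refine Set.disjoint_left.2 fun y h1 h2 => ?_
    have h3 : ((3 ^ j * a + b : ℕ) + 1 : ℝ) / 3 ^ (k + j) ≤ ((3 ^ j * a + c : ℕ) : ℝ) / 3 ^ (k + j) := by
      gcongr
      exact_mod_cast (by omega : 3 ^ j * a + (b : ℕ) + 1 ≤ 3 ^ j * a + c)
    linarith [h1.2, h2.1, hJr b, hJl c]
  refine ⟨2 ^ j, fun i => J (e.symm i), fun i i' hii' => ?_, fun i => hJf _, fun i => hJt _, ?_⟩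
  · have hne : ((e.symm i : cantorCells j) : ℕ) ≠ (e.symm i' : cantorCells j) := fun h =>
      hii' (e.symm.injective (Subtype.ext h))
    rcases lt_or_gt_of_ne hne with h | h
    · exact hsep _ _ h
    · exact (hsep _ _ h).symm
  · calc B ≤ 2 ^ j * (√L / 32) := hj2
      _ = ∑ _i : Fin (2 ^ j), √L / 32 := by simp
      _ ≤ _ := Finset.sum_le_sum fun i _ => hJs _

/-! ### Power means -/

/-- Jensen's inequality for the convex function `t ^ r`. -/
theorem mean_le_rpow_mean {c d r : ℝ} (hcd : c < d) (hr : 1 ≤ r) {g : ℝ → ℝ}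
    (hg : IntervalIntegrable g volume c d)
    (hgr : IntervalIntegrable (fun y => |g y| ^ r) volume c d) :
    (1 / (d - c)) * ∫ y in c..d, |g y| ≤ ((1 / (d - c)) * ∫ y in c..d, |g y| ^ r) ^ (1 / r) := by
  have hr0 : 0 < r := by linarith
  have hpos : 0 < d - c := sub_pos.2 hcd
  have hJ := (convexOn_rpow hr).map_set_average_le (μ := volume) (t := Ioc c d)
    (f := fun y => |g y|)
    (continuousOn_id.rpow_const fun _ _ => Or.inr hr0.le) isClosed_Ici (by simp [hcd])
    (by simp) (Eventually.of_forall fun y => abs_nonneg (g y))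
    (((intervalIntegrable_iff_integrableOn_Ioc_of_le hcd.le).1 hg.abs))
    ((intervalIntegrable_iff_integrableOn_Ioc_of_le hcd.le).1 hgr)
  simp only [setAverage_eq, Real.volume_real_Ioc_of_le hcd.le, smul_eq_mul,
    ← intervalIntegral.integral_of_le hcd.le, ← one_div] at hJ
  have h0 : 0 ≤ (1 / (d - c)) * ∫ y in c..d, |g y| :=
    mul_nonneg (by positivity) (intervalIntegral.integral_nonneg hcd.le fun y _ => abs_nonneg _)
  calc (1 / (d - c)) * ∫ y in c..d, |g y|
      = (((1 / (d - c)) * ∫ y in c..d, |g y|) ^ r) ^ (1 / r) := by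
        rw [← Real.rpow_mul h0, mul_one_div_cancel hr0.ne', Real.rpow_one]
    _ ≤ _ := Real.rpow_le_rpow (by positivity) hJ (by positivity)

theorem InLr.integrableOn {r a b : ℝ} (hr : 1 ≤ r) {G : ℝ → ℝ} (hG : InLr r a b G) :
    IntegrableOn G (Icc a b) :=
  MemLp.integrable (ENNReal.one_le_ofReal.2 hr) hG

theorem meanDeviation_le {r a b : ℝ} (hr : 1 ≤ r) {G : ℝ → ℝ} (hG : InLr r a b G) (f : ℝ → ℝ)
    (I : TaggedInterval a b) :
    meanDeviation G f I ≤ ((1 / (I.right - I.left)) *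
      ∫ y in I.left..I.right, |G y - G I.tag - f I.tag * (y - I.tag)| ^ r) ^ (1 / r) := by
  have hr0 : 0 < r := by linarith
  have hlr := I.left_lt_right
  have hl : I.left ∈ Icc a b := ⟨I.a_le_left, hlr.le.trans I.right_le_b⟩
  have hr' : I.right ∈ Icc a b := ⟨I.a_le_left.trans hlr.le, I.right_le_b⟩
  have hlin : MemLp (fun y => f I.tag * (y - I.tag)) (ENNReal.ofReal r)
      (volume.restrict (Icc a b)) := by
    have hc : Continuous fun y => f I.tag * (y - I.tag) := by fun_prop
    obtain ⟨K, hK⟩ := isCompact_Icc.exists_bound_of_continuousOn (s := Icc a b) hc.continuousOn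
    exact MemLp.of_bound hc.aestronglyMeasurable K
      ((ae_restrict_mem measurableSet_Icc).mono hK)
  have hmem : MemLp (fun y => G y - G I.tag - f I.tag * (y - I.tag)) (ENNReal.ofReal r)
      (volume.restrict (Icc a b)) :=
    (MemLp.sub hG (memLp_const _)).sub hlin
  have hpow := hmem.integrable_norm_rpow'
  rw [ENNReal.toReal_ofReal hr0.le] at hpow
  exact mean_le_rpow_mean hlr hr
    (intervalIntegrable_of_mem_Icc (hmem.integrable (ENNReal.one_le_ofReal.2 hr)) hl hr')
    (intervalIntegrable_of_mem_Icc hpow hl hr')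

/-! ### The counterexample -/

/-- The derivative of `cantorBump` off the Cantor set, extended by zero. -/
noncomputable def cantorBumpDeriv : ℝ → ℝ := cantorSetᶜ.indicator (deriv cantorBump)

theorem hasDerivAt_cantorBump {x : ℝ} (hx : x ∈ Icc (0 : ℝ) 1 \ cantorSet) :
    HasDerivAt cantorBump (cantorBumpDeriv x) x := by
  obtain ⟨hmem, hgap⟩ := exists_isCantorGap hx.1 hx.2
  rw [cantorBumpDeriv, indicator_of_mem (show x ∈ cantorSetᶜ from hx.2)]
  exact (hgap.hasDerivAt_cantorBump hmem).differentiableAt.hasDerivAt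

theorem cantorBumpDeriv_of_mem {x : ℝ} (hx : x ∈ cantorSet) : cantorBumpDeriv x = 0 :=
  indicator_of_notMem (notMem_compl_iff.2 hx) _

theorem ae_notMem_cantorSet :
    ∀ᵐ x ∂(volume.restrict (Icc (0 : ℝ) 1)), x ∈ Icc (0 : ℝ) 1 \ cantorSet := by
  filter_upwards [ae_restrict_mem measurableSet_Icc,
    ae_restrict_of_ae (measure_eq_zero_iff_ae_notMem.1 volume_cantorSet)] with x h1 h2
  exact ⟨h1, h2⟩

theorem mem_Ioo_of_notMem_cantorSet {x : ℝ} (hx : x ∈ Icc (0 : ℝ) 1 \ cantorSet) :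
    x ∈ Ioo (0 : ℝ) 1 :=
  ⟨lt_of_le_of_ne hx.1.1 fun h => hx.2 (h ▸ zero_mem_cantorSet),
    lt_of_le_of_ne hx.1.2 fun h => hx.2 (h ▸ one_mem_cantorSet)⟩

theorem khintchineIntegrable_cantorBumpDeriv : KhintchineIntegrable 0 1 cantorBumpDeriv :=
  ⟨cantorBump, continuousOn_cantorBump, isACG_cantorBump,
    ae_notMem_cantorSet.mono fun _ hx => (hasDerivAt_cantorBump hx).hasDerivWithinAt⟩

theorem denjoyKhintchineIntegrable_cantorBumpDeriv :
    DenjoyKhintchineIntegrable 0 1 cantorBumpDeriv :=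
  ⟨cantorBump, continuousOn_cantorBump, isACG_cantorBump,
    ae_notMem_cantorSet.mono fun _ hx => hasApproxDerivAt_of_hasDerivAt continuousOn_cantorBump
      (mem_Ioo_of_notMem_cantorSet hx) (hasDerivAt_cantorBump hx)⟩

theorem integrableOn_cantorBump : IntegrableOn cantorBump (Icc 0 1) :=
  continuousOn_cantorBump.integrableOn_Icc

theorem inLr_cantorBump (r : ℝ) : InLr r 0 1 cantorBump := by
  obtain ⟨K, hK⟩ := isCompact_Icc.exists_bound_of_continuousOn continuousOn_cantorBump
  exact MemLp.of_bound (continuousOn_cantorBump.aestronglyMeasurable measurableSet_Icc) K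
    ((ae_restrict_mem measurableSet_Icc).mono hK)

theorem not_hkrIntegrable_cantorBumpDeriv {r : ℝ} (hr : 1 ≤ r) :
    ¬ HKrIntegrable r 0 1 cantorBumpDeriv := by
  rintro ⟨G, hG, H⟩
  have hGi := hG.integrableOn hr
  have hgap : ∀ u v, IsCantorGap u v → ∀ c,
      (v - u) * √(v - u) / 16 ≤ ∫ y in u..v, |G y - c| := by
    intro u v hg
    refine le_integral_abs_sub hg.lt (hGi.mono_set hg.Icc_subset)
      (κ := (∫ y in u..v, (G y - cantorBump y)) / (v - u)) fun x hx => ?_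
    rw [← integral_sub_eq_of_meanDeviation hGi integrableOn_cantorBump (f := cantorBumpDeriv)
      (fun ε hε => ?_) hg.lt hg.Icc_subset (fun y hy => hasDerivAt_cantorBump
        ⟨hg.Icc_subset (Ioo_subset_Icc_self hy), hg.notMem y hy⟩) hx]
    · refine intervalIntegral.integral_congr fun y hy => ?_
      rw [uIcc_of_le hx.1] at hy
      rw [hg.cantorBump_eq ⟨hy.1, hy.2.trans hx.2⟩]
    · obtain ⟨δ, hδ, hsum⟩ := H ε hε
      exact ⟨δ, hδ, fun q I hI hf =>
        (Finset.sum_le_sum fun i _ => meanDeviation_le hr hG _ (I i)).trans (hsum q I hI hf).le⟩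
  obtain ⟨δ, hδ, hsum⟩ := H 1 one_pos
  obtain ⟨q, I, hI, hf, ht, hle⟩ := exists_fine_division_large hGi hgap
    (fun x hx => hδ x (cantorSet_subset_unitInterval hx)) 1
  refine absurd (hle.trans (Finset.sum_le_sum fun i _ => ?_)) (not_le.2 (hsum q I hI hf))
  refine le_trans (le_of_eq ?_) (meanDeviation_le hr hG cantorBumpDeriv (I i))
  -- At tags in C the slope vanishes, so the deviation is the plain mean oscillation.
  simp [meanDeviation, cantorBumpDeriv_of_mem (ht i)]

theorem lrVariationalMeasure_cantorBump {r : ℝ} (hr : 1 ≤ r) :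
    lrVariationalMeasure r 0 1 cantorBump cantorSet = ⊤ := by
  simp only [lrVariationalMeasure, iInf_eq_top]
  intro δ hδ
  have hgap : ∀ u v, IsCantorGap u v → ∀ c,
      (v - u) * √(v - u) / 16 ≤ ∫ y in u..v, |cantorBump y - c| := by
    intro u v hg
    refine le_integral_abs_sub hg.lt (integrableOn_cantorBump.mono_set hg.Icc_subset) (κ := 0)
      fun x hx => ?_
    rw [zero_mul, ← intervalIntegral.integral_zero (a := u) (b := x)]
    refine intervalIntegral.integral_congr fun y hy => ?_
    rw [uIcc_of_le hx.1] at hy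
    rw [hg.cantorBump_eq ⟨hy.1, hy.2.trans hx.2⟩, sub_self]
  refine ENNReal.eq_top_of_forall_nnreal_le fun B => ?_
  obtain ⟨q, I, hI, hf, ht, hle⟩ := exists_fine_division_large integrableOn_cantorBump hgap hδ B
  have hle' : (B : ℝ) ≤ ∑ i, lrDelta r cantorBump (I i) := by
    refine hle.trans (Finset.sum_le_sum fun i _ => ?_)
    -- With slope function 0 the deviation from the expansion is the oscillation.
    simpa [meanDeviation, lrDelta] using meanDeviation_le hr (inLr_cantorBump r) 0 (I i)
  calc (B : ENNReal) = ENNReal.ofReal B := (ENNReal.ofReal_coe_nnreal).symm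
    _ ≤ ENNReal.ofReal (∑ i, lrDelta r cantorBump (I i)) := ENNReal.ofReal_le_ofReal hle'
    _ ≤ lrVariation r 0 1 cantorBump cantorSet δ :=
      le_iSup_of_le q (le_iSup_of_le I (le_iSup_of_le hI (le_iSup_of_le hf
        (le_iSup_of_le ht le_rfl))))

end LrHK

theorem mainTheorem4 :
    ∃ f : ℝ → ℝ,
      LrHK.KhintchineIntegrable 0 1 f ∧
      LrHK.DenjoyKhintchineIntegrable 0 1 f ∧
      (∀ r : ℝ, 1 ≤ r → ¬ LrHK.HKrIntegrable r 0 1 f) ∧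
      ∃ F : ℝ → ℝ,
        ContinuousOn F (Set.Icc 0 1) ∧
        LrHK.IsACG 0 1 F ∧
        (∀ x ∈ Set.Icc (0 : ℝ) 1 \ cantorSet, HasDerivAt F (f x) x) ∧
        ∀ r : ℝ, 1 ≤ r → LrHK.lrVariationalMeasure r 0 1 F cantorSet = ⊤ :=
  ⟨LrHK.cantorBumpDeriv, LrHK.khintchineIntegrable_cantorBumpDeriv,
    LrHK.denjoyKhintchineIntegrable_cantorBumpDeriv,
    fun _ hr => LrHK.not_hkrIntegrable_cantorBumpDeriv hr,
    LrHK.cantorBump, LrHK.continuousOn_cantorBump, LrHK.isACG_cantorBump,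
    fun _ hx => LrHK.hasDerivAt_cantorBump hx,
    fun _ hr => LrHK.lrVariationalMeasure_cantorBump hr⟩
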